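/- Let $(X,\mathcal B,\mu)$ be a standard (Lebesgue) probability space and let $T=(T_g)_{g\in G}$ be a measure-preserving action of a group $G$ on it, i.e. a homomorphism from $G$ to the group of automorphisms of $(X,\mu)$ modulo null sets. A self-joining of order $n\ge 1$ of $T$ is a measure $\nu$ on $X^n$ all of whose one-dimensional marginals equal $\mu$ and which is invariant under the diagonal maps $T_g\times\dots\times T_g$, $g\in G$. It is nontrivial if $\nu\neq\mu^{n}$ (the product of $n$ copies of $\mu$). It is of class $M(m,n)$, $m<n$, if all its projections to $m$-dimensional faces of $X^n$ equal $\mu^{m}$; it is pairwise independent if all its projections to two-dimensional faces equal $\mu\times\mu$. Theorem. If $T$ has, for some $n>2$, a nontrivial self-joining of order $n$ with pairwise independence, then for every integer $p>1$ it has a nontrivial self-joining of class $M(2p-1,2p)$. Corollary. Let $G$ be a commutative topological group (for instance a discrete one). Say that $T$ is mixing of multiplicity $k\ge 1$ if for all measurable $A_0,\dots,A_k$ $$\mu(A_0\cap T_{g_1}A_1\cap\dots\cap T_{g_k}A_k)\to\mu(A_0)\mu(A_1)\cdots\mu(A_k)$$ as $g_i\to\infty$ for all $i$ and $g_i^{-1}g_j\to\infty$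 for all $i\ne j$ (where $\to\infty$ means leaving every compact subset of $G$), and mixing if it is mixing of multiplicity $1$. If $T$ is mixing, but for some $k>1$ is not mixing of multiplicity $k$, then for every integer $p>1$ it has a nontrivial self-joining of class $M(2p-1,2p)$. -/

import Mathlib

open MeasureTheory Filter Topology

namespace Joinings

/-- A measure-preserving action of a group `G` on a probability space `(X, μ)`. As usual in ergodic
theory, automorphisms are taken modulo null sets: the group laws are required to hold almost
everywhere (separately for each pair of group elements). Genuine pointwise actions by
measure-preserving maps are a special case. -/
structure MPAction (G : Type*) [Group G] {X : Type*} [MeasurableSpace X] (μ : Measure X) where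
  toFun : G → X → X
  measurePreserving : ∀ g, MeasurePreserving (toFun g) μ μ
  map_one : toFun 1 =ᵐ[μ] id
  map_mul : ∀ g h, toFun (g * h) =ᵐ[μ] toFun g ∘ toFun h

variable {G X : Type*} [Group G] [MeasurableSpace X] {μ : Measure X}

/-- `ν` is a self-joining of order `n`: a measure on the cube `X ^ n` whose one-dimensional
marginals are all equal to `μ` and which is invariant under the diagonal action. -/
structure IsSelfJoining (T : MPAction G μ) (n : ℕ) (ν : Measure (Fin n → X)) : Prop where
  marginal : ∀ i : Fin n, ν.map (fun x => x i) = μ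
  invariant : ∀ g : G, ν.map (fun x i => T.toFun g (x i)) = ν

/-- The class `M(m, n)`: self-joinings of order `n` whose projections to all `m`-dimensional
faces of the cube `X ^ n` are equal to the product measure `μ ^ m`. -/
structure IsClassM (T : MPAction G μ) (m n : ℕ) (ν : Measure (Fin n → X)) : Prop
    extends IsSelfJoining T n ν where
  face : ∀ s : Finset (Fin n), s.card = m → ν.map s.restrict = Measure.pi (fun _ : s => μ)

/-- A self-joining of order `n` with pairwise independence: all projections to two-dimensional
faces are `μ × μ`. -/
def IsPairwiseIndependent (T : MPAction G μ) (n : ℕ) (ν : Measure (Fin n → X)) : Prop :=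
  IsClassM T 2 n ν

/-- A measure on the cube `X ^ n` is nontrivial (relative to `μ`) if it differs from `μ ^ n`. -/
def IsNontrivial (μ : Measure X) (n : ℕ) (ν : Measure (Fin n → X)) : Prop :=
  ν ≠ Measure.pi (fun _ : Fin n => μ)

/-- The filter on `k`-tuples `(g₁, …, g_k)` of elements of a topological group along which, with
`g₀ = 1`, all the quotients `g_i⁻¹ g_j`, `i ≠ j`, leave every compact set. -/
def tendToInfinityApart (G : Type*) [Group G] [TopologicalSpace G] (k : ℕ) :
    Filter (Fin k → G) :=
  ⨅ (i : Fin (k + 1)) (j : Fin (k + 1)) (_ : i ≠ j),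
    comap (fun g : Fin k → G =>
      ((Fin.cons 1 g : Fin (k + 1) → G) i)⁻¹ * (Fin.cons 1 g : Fin (k + 1) → G) j)
      (cocompact G)

/-- Mixing of multiplicity `k`: for all measurable `A₀, …, A_k`,
`μ (A₀ ∩ T_{g₁} A₁ ∩ … ∩ T_{g_k} A_k) → μ A₀ μ A₁ ⋯ μ A_k` as `g₁, …, g_k` and their mutual
quotients tend to infinity. The set `T_g A` is written as the preimage of `A` under `T_{g⁻¹}`,
with which it agrees modulo null sets. -/
def IsMixingOfMultiplicity [TopologicalSpace G] (T : MPAction G μ) (k : ℕ) : Prop :=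
  ∀ A : Fin (k + 1) → Set X, (∀ i, MeasurableSet (A i)) →
    Tendsto
      (fun g : Fin k → G =>
        μ (⋂ i, T.toFun ((Fin.cons 1 g : Fin (k + 1) → G) i)⁻¹ ⁻¹' A i))
      (tendToInfinityApart G k) (𝓝 (∏ i, μ (A i)))

/-- Mixing is mixing of multiplicity one. -/
def IsMixing [TopologicalSpace G] (T : MPAction G μ) : Prop :=
  IsMixingOfMultiplicity T 1

end Joinings

/-! Choose a minimal face on which the joining is not a product. Pairwise independence forces its
dimension `m` above 2, and every proper face of it is a product.

Split the `m` coordinates into nonempty blocks `ι` and `κ`, and let `K z` be the law of the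
`ι`-block given the `κ`-block `z`. The relatively independent square `∫ K z × K z` lives on `2 *
|ι|` coordinates. If one coordinate of a copy of `ι` is left free, that copy's factor is a.e.
constant in `z`, so all proper faces are again products. Were the whole square a product, each `K z
A` would have zero variance, hence be constant, and the original joining would be a product
(`HasProperJoining.square`). Thus order `m` yields order `2 * a` for every `0 < a < m`. Since `2 *
(m - 1) > m` for `m > 2`, the order can be made larger than `p`, and then `a = p` finishes.

For the corollary, a failure of multiple mixing gives a limit of graph joinings that is not a
product. Mixing makes its pairs independent, and commutativity makes it invariant. The limit exists
because couplings with fixed marginals are tight (`exists_tendsto_rectangles`). -/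

namespace Joinings

/-! ### Rectangles, faces and minimal non-product faces. -/

/-- Finite measures on a finite power which agree on measurable rectangles are equal. -/
theorem measure_ext_of_rectangles {ι X : Type*} [Fintype ι] [MeasurableSpace X]
    {ν ρ : Measure (ι → X)} [IsFiniteMeasure ν]
    (h : ∀ A : ι → Set X, (∀ i, MeasurableSet (A i)) →
      ν (Set.univ.pi A) = ρ (Set.univ.pi A)) : ν = ρ := by
  refine ext_of_generate_finite _ generateFrom_pi.symm (isPiSystem_pi) ?_ ?_
  · rintro _ ⟨A, hA, rfl⟩
    exact h A fun i => hA i (Set.mem_univ i)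
  · simpa using h (fun _ => Set.univ) fun _ => MeasurableSet.univ

/-- Measurable rectangles with at least one full side have product measure: every proper face of
the cube carries the product measure. -/
def ProperlyIndependent {ι X : Type*} [Fintype ι] [MeasurableSpace X] (μ : Measure X)
    (ν : Measure (ι → X)) : Prop :=
  ∀ A : ι → Set X, (∀ i, MeasurableSet (A i)) → (∃ i, A i = Set.univ) →
    ν (Set.univ.pi A) = ∏ i, μ (A i)

/-- Invariance of a measure on a power of `X` under the diagonal action. -/
def DiagonalInvariant {G X ι : Type*} [Group G] [MeasurableSpace X] {μ : Measure X}
    (T : MPAction G μ) (ν : Measure (ι → X)) : Prop :=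
  ∀ g, ν.map (fun x i => T.toFun g (x i)) = ν

/-- There is a nontrivial invariant measure on `ι → X` all of whose proper faces are product
measures. -/
def HasProperJoining {G X : Type*} [Group G] [MeasurableSpace X] {μ : Measure X}
    (T : MPAction G μ) (ι : Type) [Fintype ι] : Prop :=
  ∃ ν : Measure (ι → X), DiagonalInvariant T ν ∧ ProperlyIndependent μ ν ∧
    ν ≠ Measure.pi fun _ => μ

section
variable {G X : Type*} [Group G] [MeasurableSpace X] {μ : Measure X}

theorem MPAction.measurable (T : MPAction G μ) (g : G) : Measurable (T.toFun g) :=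
  (T.measurePreserving g).measurable

theorem MPAction.measurable_diagonal (T : MPAction G μ) (g : G) (ι : Type*) :
    Measurable fun (x : ι → X) i => T.toFun g (x i) :=
  measurable_pi_lambda _ fun i => (T.measurable g).comp (measurable_pi_apply i)

theorem MPAction.inv_comp (T : MPAction G μ) (g : G) : T.toFun g⁻¹ ∘ T.toFun g =ᵐ[μ] id := by
  have h := T.map_mul g⁻¹ g
  rw [inv_mul_cancel] at h
  exact h.symm.trans T.map_one

theorem MPAction.measurePreserving_diagonal [IsProbabilityMeasure μ] (T : MPAction G μ) (g : G)
    (ι : Type*) [Fintype ι] :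
    MeasurePreserving (fun (x : ι → X) i => T.toFun g (x i))
      (Measure.pi fun _ => μ) (Measure.pi fun _ => μ) :=
  measurePreserving_pi _ _ fun _ => T.measurePreserving g

theorem DiagonalInvariant.rectangle {T : MPAction G μ} {ι : Type*} [Fintype ι]
    {ν : Measure (ι → X)} (h : DiagonalInvariant T ν) (g : G) {A : ι → Set X}
    (hA : ∀ i, MeasurableSet (A i)) :
    ν (Set.univ.pi fun i => T.toFun g ⁻¹' A i) = ν (Set.univ.pi A) := by
  conv_rhs => rw [← h g, Measure.map_apply (T.measurable_diagonal g ι) (.univ_pi hA)]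
  rfl

theorem diagonalInvariant_of_rectangles {T : MPAction G μ} {ι : Type*} [Fintype ι]
    {ν : Measure (ι → X)} [IsFiniteMeasure ν]
    (h : ∀ g, ∀ A : ι → Set X, (∀ i, MeasurableSet (A i)) →
      ν (Set.univ.pi fun i => T.toFun g ⁻¹' A i) = ν (Set.univ.pi A)) :
    DiagonalInvariant T ν := by
  intro g
  refine measure_ext_of_rectangles fun A hA => ?_
  rw [Measure.map_apply (T.measurable_diagonal g ι) (.univ_pi hA)]
  exact h g A hA

theorem ProperlyIndependent.isProbabilityMeasure [IsProbabilityMeasure μ] {ι : Type*} [Fintype ι]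
    [Nonempty ι] {ν : Measure (ι → X)} (h : ProperlyIndependent μ ν) : IsProbabilityMeasure ν :=
  ⟨by simpa using h (fun _ => Set.univ) (fun _ => .univ) ⟨Classical.arbitrary ι, rfl⟩⟩

/-- Projection to the coordinates selected by `e`. -/
theorem measurable_reindex {ι κ : Type*} (e : κ → ι) :
    Measurable fun (x : ι → X) k => x (e k) :=
  measurable_pi_lambda _ fun _ => measurable_pi_apply _

theorem map_reindex_rectangle {ι κ : Type*} [Fintype ι] [Fintype κ] (e : κ → ι)
    (he : Function.Injective e) (ν : Measure (ι → X)) {A : κ → Set X}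
    (hA : ∀ i, MeasurableSet (A i)) :
    ν.map (fun x k => x (e k)) (Set.univ.pi A) =
      ν (Set.univ.pi (Function.extend e A fun _ => Set.univ)) := by
  rw [Measure.map_apply (measurable_reindex e) (.univ_pi hA)]
  congr 1
  ext x
  simp only [Set.mem_preimage, Set.mem_pi, Set.mem_univ, true_implies]
  constructor
  · intro h i
    by_cases hi : ∃ k, e k = i
    · obtain ⟨k, rfl⟩ := hi
      rw [he.extend_apply]; exact h k
    · rw [Function.extend_apply' _ _ _ hi]; trivial
  · intro h k
    simpa [he.extend_apply] using h (e k)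

theorem measurableSet_extend {ι κ : Type*} {e : κ → ι} (he : Function.Injective e) {A : κ → Set X}
    (hA : ∀ i, MeasurableSet (A i)) (i : ι) :
    MeasurableSet (Function.extend e A (fun _ => Set.univ) i) := by
  by_cases hi : ∃ k, e k = i
  · obtain ⟨k, rfl⟩ := hi
    rw [he.extend_apply]; exact hA k
  · rw [Function.extend_apply' _ _ _ hi]; exact .univ

theorem prod_extend [IsProbabilityMeasure μ] {ι κ : Type*} [Fintype ι] [Fintype κ] {e : κ → ι}
    (he : Function.Injective e) (A : κ → Set X) :
    ∏ i, μ (Function.extend e A (fun _ => Set.univ) i) = ∏ k, μ (A k) := by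
  classical
  rw [← Finset.prod_subset (Finset.subset_univ (Finset.univ.image e)),
    Finset.prod_image fun _ _ _ _ h => he h]
  · simp [he.extend_apply]
  · intro i _ hi
    rw [Function.extend_apply' _ _ _ (by simpa using hi), measure_univ]

theorem DiagonalInvariant.map_reindex {T : MPAction G μ} {ι κ : Type*}
    {ν : Measure (ι → X)} (h : DiagonalInvariant T ν) (e : κ → ι) :
    DiagonalInvariant T (ν.map fun x k => x (e k)) := by
  intro g
  rw [Measure.map_map (T.measurable_diagonal g κ) (measurable_reindex e)]
  conv_rhs => rw [← h g, Measure.map_map (measurable_reindex e) (T.measurable_diagonal g ι)]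
  rfl

theorem HasProperJoining.reindex [IsProbabilityMeasure μ] {T : MPAction G μ} {ι κ : Type}
    [Fintype ι] [Fintype κ] (e : κ ≃ ι) (h : HasProperJoining T ι) : HasProperJoining T κ := by
  obtain ⟨ν, hinv, hind, hne⟩ := h
  refine ⟨ν.map fun x k => x (e k), hinv.map_reindex e, ?_, ?_⟩
  · rintro A hA ⟨k, hk⟩
    rw [map_reindex_rectangle e e.injective ν hA, hind _ (measurableSet_extend e.injective hA),
      prod_extend e.injective]
    exact ⟨e k, by rw [e.injective.extend_apply, hk]⟩
  · intro heq
    apply hne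
    refine (Measure.pi_eq fun A hA => ?_).symm
    have := map_reindex_rectangle e e.injective ν (A := fun k => A (e k)) fun k => hA _
    rw [heq, Measure.pi_pi] at this
    rw [← Equiv.prod_comp e fun i => μ (A i), this]
    congr 2
    ext1 i
    obtain ⟨k, rfl⟩ := e.surjective i
    rw [e.injective.extend_apply]

/-- Passing to a minimal face which is not a product measure. -/
theorem exists_hasProperJoining [IsProbabilityMeasure μ] {T : MPAction G μ} {n : ℕ} (hn : 2 < n)
    {ν : Measure (Fin n → X)} (hν : IsPairwiseIndependent T n ν) (hne : IsNontrivial μ n ν) :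
    ∃ m : ℕ, 2 < m ∧ HasProperJoining T (Fin m) := by
  classical
  -- The face over `s` is not a product, expressed by rectangles of the whole cube so that different
  -- `s` can be compared.
  let bad : Finset (Fin n) → Prop := fun s => ∃ A : Fin n → Set X, (∀ i, MeasurableSet (A i)) ∧
    (∀ i ∉ s, A i = Set.univ) ∧ ν (Set.univ.pi A) ≠ ∏ i, μ (A i)
  have hrect : ∀ (s : Finset (Fin n)) {A : s → Set X}, (∀ i, MeasurableSet (A i)) →
      ν.map s.restrict (Set.univ.pi A) =
        ν (Set.univ.pi (Function.extend Subtype.val A fun _ => Set.univ)) := fun s A hA =>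
    map_reindex_rectangle (fun i : s => (i : Fin n)) Subtype.val_injective ν hA
  have hext : ∀ (s : Finset (Fin n)) (A : Fin n → Set X), (∀ i ∉ s, A i = Set.univ) →
      Function.extend Subtype.val (fun i : s => A i) (fun _ => Set.univ) = A := by
    intro s A h
    ext1 i
    by_cases hi : i ∈ s
    · exact Subtype.val_injective.extend_apply (fun i : s => A i) _ ⟨i, hi⟩
    · rw [Function.extend_apply' _ _ _ (by simpa using hi), h i hi]
  have huniv : bad Finset.univ := by
    by_contra h
    refine hne (Measure.pi_eq fun A hA => ?_).symm
    by_contra h'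
    exact h ⟨A, hA, by simp, h'⟩
  obtain ⟨s, hs, hmin⟩ := (Set.toFinite {s | bad s}).exists_minimalFor Finset.card _ ⟨_, huniv⟩
  have hcard : 2 < s.card := by
    by_contra! h
    -- At most two coordinates fit into a pair, since `2 < n`, and pairs carry `μ × μ`.
    obtain ⟨t, hst, ht⟩ := Finset.exists_superset_card_eq h (by simpa using hn.le)
    obtain ⟨A, hA, hAs, hbad⟩ := hs
    have hAt := hext t A fun i hi => hAs i fun h => hi (hst h)
    apply hbad
    conv_lhs => rw [← hAt]
    rw [← hrect t fun i => hA _, hν.face t ht, Measure.pi_pi,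
      ← prod_extend (μ := μ) Subtype.val_injective, hAt]
  refine ⟨s.card, hcard, HasProperJoining.reindex s.equivFin.symm
    ⟨ν.map fun x (i : s) => x i, DiagonalInvariant.map_reindex hν.invariant _, ?_, ?_⟩⟩
  · rintro A hA ⟨⟨i, hi⟩, hAi⟩
    have hgood : ¬ bad (s.erase i) := fun h => by
      have := hmin h (Finset.card_le_card (Finset.erase_subset i s))
      have := Finset.card_erase_lt_of_mem hi
      omega
    refine (hrect s hA).trans ?_
    rw [← prod_extend (μ := μ) Subtype.val_injective A]
    by_contra hbad
    refine hgood ⟨_, measurableSet_extend Subtype.val_injective hA, fun j hj => ?_, hbad⟩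
    by_cases hjs : j ∈ s
    · obtain rfl : j = i := by simpa [hjs] using hj
      exact (Subtype.val_injective.extend_apply A _ ⟨j, hi⟩).trans hAi
    · rw [Function.extend_apply' _ _ _ (by simpa using hjs)]
  · intro h
    obtain ⟨A, hA, hAs, hbad⟩ := hs
    apply hbad
    have h2 := hrect s (A := fun i => A i) fun i => hA i
    rw [hext s A hAs] at h2
    rw [← h2, ← hext s A hAs, prod_extend Subtype.val_injective]
    change ν.map (fun x (i : s) => x i) _ = _
    rw [h, Measure.pi_pi]
    simp

/-- A properly independent joining of order `n` belongs to the class `M (n - 1, n)`. -/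
theorem HasProperJoining.exists_isClassM [IsProbabilityMeasure μ] {T : MPAction G μ} {n : ℕ}
    (hn : 1 < n) (h : HasProperJoining T (Fin n)) :
    ∃ ν : Measure (Fin n → X), IsClassM T (n - 1) n ν ∧ IsNontrivial μ n ν := by
  obtain ⟨ν, hinv, hind, hne⟩ := h
  have hface : ∀ (κ : Type) [Fintype κ] (e : κ → Fin n), Function.Injective e →
      (∃ i, i ∉ Set.range e) → ν.map (fun x k => x (e k)) = Measure.pi fun _ => μ := by
    rintro κ _ e he ⟨i, hi⟩
    refine (Measure.pi_eq fun A hA => ?_).symm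
    rw [map_reindex_rectangle e he ν hA, hind _ (measurableSet_extend he hA), prod_extend he]
    exact ⟨i, Function.extend_apply' _ _ _ hi⟩
  refine ⟨ν, ⟨⟨fun i => ?_, hinv⟩, fun s hs => ?_⟩, hne⟩
  · obtain ⟨j, hj⟩ : ∃ j : Fin n, j ≠ i :=
      have : Nontrivial (Fin n) := Fin.nontrivial_iff_two_le.2 hn
      exists_ne i
    have h1 := hface Unit (fun _ => i) (fun _ _ _ => rfl) ⟨j, by simpa using hj⟩
    rw [← (measurePreserving_eval (fun _ : Unit => μ) ()).map_eq, ← h1,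
      Measure.map_map (measurable_pi_apply _) (measurable_reindex fun _ : Unit => i)]
    rfl
  · refine hface s Subtype.val Subtype.val_injective ?_
    have hlt : s.card < Fintype.card (Fin n) := by simp; omega
    obtain ⟨i, hi⟩ := (Finset.card_lt_iff_ne_univ s).1 hlt |> fun h => by
      simpa [Finset.eq_univ_iff_forall] using h
    exact ⟨i, by simpa using hi⟩

end

/-! ### Relatively independent squares. -/

section
open ProbabilityTheory

/-- If the square of a `[0, 1]`-valued function integrates to the square of its mean, the function
is almost everywhere constant. -/
theorem ae_eq_const_of_lintegral_mul_self {Z : Type*} [MeasurableSpace Z] {σ : Measure Z}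
    [IsProbabilityMeasure σ] {f : Z → ENNReal} (hf : Measurable f) (hf1 : ∀ z, f z ≤ 1)
    {c : ENNReal} (hc : ∫⁻ z, f z ∂σ = c) (hcc : ∫⁻ z, f z * f z ∂σ = c * c) :
    f =ᵐ[σ] fun _ => c := by
  have hfin : ∀ z, f z ≠ ⊤ := fun z => ne_top_of_le_ne_top ENNReal.one_ne_top (hf1 z)
  have hctop : c ≠ ⊤ := by
    rw [← hc]
    exact ne_top_of_le_ne_top ENNReal.one_ne_top
      ((lintegral_mono hf1).trans (by simp))
  let g : Z → ℝ := fun z => (f z).toReal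
  have hg : Measurable g := hf.ennreal_toReal
  have hg0 : ∀ z, 0 ≤ g z := fun z => ENNReal.toReal_nonneg
  have hg1 : ∀ z, g z ≤ 1 := fun z => by
    simpa using ENNReal.toReal_mono ENNReal.one_ne_top (hf1 z)
  have hgi : Integrable g σ := Integrable.of_bound hg.aestronglyMeasurable 1
    (.of_forall fun z => by rw [Real.norm_of_nonneg (hg0 z)]; exact hg1 z)
  have hggi : Integrable (fun z => g z * g z) σ :=
    Integrable.of_bound (hg.mul hg).aestronglyMeasurable 1
      (.of_forall fun z => by
        rw [Real.norm_of_nonneg (mul_nonneg (hg0 z) (hg0 z))]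
        exact mul_le_one₀ (hg1 z) (hg0 z) (hg1 z))
  have h1 : ∫ z, g z ∂σ = c.toReal := by
    rw [← hc]
    exact integral_toReal hf.aemeasurable (.of_forall fun z => (hfin z).lt_top)
  have h2 : ∫ z, g z * g z ∂σ = c.toReal * c.toReal := by
    rw [← ENNReal.toReal_mul, ← hcc]
    simp only [g, ← ENNReal.toReal_mul]
    exact integral_toReal (hf.mul hf).aemeasurable
      (.of_forall fun z => ENNReal.mul_lt_top (hfin z).lt_top (hfin z).lt_top)
  have hexp : ∀ z, (g z - c.toReal) ^ 2 =
      g z * g z - 2 * c.toReal * g z + c.toReal * c.toReal := fun z => by ring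
  have hi : Integrable (fun z => (g z - c.toReal) ^ 2) σ := by
    simp only [hexp]
    exact (hggi.sub (hgi.const_mul _)).add (integrable_const _)
  -- The variance of `g` vanishes.
  have h3 : ∫ z, (g z - c.toReal) ^ 2 ∂σ = 0 := by
    simp only [hexp]
    rw [integral_add (f := fun z => g z * g z - 2 * c.toReal * g z)
        (hggi.sub (hgi.const_mul _)) (integrable_const _),
      integral_sub hggi (hgi.const_mul _), integral_const_mul, h1, h2]
    simp; ring
  have h4 := (integral_eq_zero_iff_of_nonneg (fun z => sq_nonneg _) hi).1 h3
  filter_upwards [h4] with z hz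
  have : g z = c.toReal := by simpa [sub_eq_zero] using hz
  exact (ENNReal.toReal_eq_toReal_iff' (hfin z) hctop).1 this

/-- The rectangle in a cube with coordinates `ι ⊕ κ` is the product of two rectangles. -/
theorem preimage_sumElim_rectangle {ι κ X : Type*} (A : ι ⊕ κ → Set X) :
    (fun p : (ι → X) × (κ → X) => (Sum.elim p.1 p.2 : ι ⊕ κ → X)) ⁻¹' Set.univ.pi A =
      Set.univ.pi (fun i => A (.inl i)) ×ˢ Set.univ.pi (fun k => A (.inr k)) := by
  ext p
  simp [Set.mem_pi]

theorem measurable_sumElim {ι κ X : Type*} [MeasurableSpace X] :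
    Measurable fun p : (ι → X) × (κ → X) => (Sum.elim p.1 p.2 : ι ⊕ κ → X) := by
  refine measurable_pi_lambda _ fun i => ?_
  cases i with
  | inl i => exact (measurable_pi_apply i).comp measurable_fst
  | inr k => exact (measurable_pi_apply k).comp measurable_snd

variable {G X : Type*} [Group G] [MeasurableSpace X] [StandardBorelSpace X] {μ : Measure X}
  [IsProbabilityMeasure μ] {ι κ : Type} [Fintype ι] [Fintype κ]

/-- A conditional distribution of the `ι`-coordinates given the `κ`-coordinates. -/
theorem exists_conditional_kernel [Nonempty ι] [Nonempty κ] {ν : Measure (ι ⊕ κ → X)}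
    (h : ProperlyIndependent μ ν) :
    ∃ K : Kernel (κ → X) (ι → X), IsMarkovKernel K ∧
      ∀ B : Set (ι → X), MeasurableSet B → ∀ C : Set (κ → X), MeasurableSet C →
        ∫⁻ z in C, K z B ∂(Measure.pi fun _ => μ) =
          ν {x | (fun i => x (.inl i)) ∈ B ∧ (fun k => x (.inr k)) ∈ C} := by
  have : IsProbabilityMeasure ν := h.isProbabilityMeasure
  have : Nonempty X := nonempty_of_isProbabilityMeasure μ
  have hm : Measurable fun x : ι ⊕ κ → X =>
      ((fun k => x (.inr k), fun i => x (.inl i)) : (κ → X) × (ι → X)) :=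
    (measurable_reindex Sum.inr).prodMk (measurable_reindex Sum.inl)
  let ρ : Measure ((κ → X) × (ι → X)) :=
    ν.map fun x => (fun k => x (.inr k), fun i => x (.inl i))
  have : IsProbabilityMeasure ρ := Measure.isProbabilityMeasure_map hm.aemeasurable
  -- The `κ`-face is proper because `ι` is nonempty, so it is a product.
  have hfst : ρ.fst = Measure.pi fun _ => μ := by
    refine (Measure.pi_eq fun A hA => ?_).symm
    rw [Measure.fst_apply (.univ_pi hA),
      Measure.map_apply hm (measurable_fst (.univ_pi hA)), 
      ← prod_extend (Sum.inr_injective (α := ι)), ← h _ (measurableSet_extend Sum.inr_injective hA)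
        ⟨.inl (Classical.arbitrary ι), Function.extend_apply' _ _ _ (by simp)⟩,
      ← map_reindex_rectangle Sum.inr Sum.inr_injective ν hA,
      Measure.map_apply (measurable_reindex _) (.univ_pi hA)]
    rfl
  refine ⟨ρ.condKernel, inferInstance, fun B hB C hC => ?_⟩
  rw [← hfst, Measure.setLIntegral_condKernel_eq_measure_prod hC hB,
    Measure.map_apply hm (hC.prod hB)]
  congr 1
  ext x
  simp [and_comm]

/-- The relatively independent square of a nontrivial, properly independent joining over a
nonempty set of coordinates. -/
theorem HasProperJoining.square [Nonempty ι] [Nonempty κ] {T : MPAction G μ}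
    (h : HasProperJoining T (ι ⊕ κ)) : HasProperJoining T (ι ⊕ ι) := by
  obtain ⟨ν, hinv, hind, hne⟩ := h
  have : IsProbabilityMeasure ν := hind.isProbabilityMeasure
  obtain ⟨K, hK, hKν⟩ := exists_conditional_kernel hind
  set σ : Measure (κ → X) := Measure.pi fun _ => μ with hσ
  have hKm : ∀ {B}, MeasurableSet B → Measurable fun z => K z B := fun hB =>
    Kernel.measurable_coe K hB
  have hKr : ∀ (A : ι → Set X) (C : κ → Set X), (∀ i, MeasurableSet (A i)) →
      (∀ i, MeasurableSet (C i)) →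
      ∫⁻ z in Set.univ.pi C, K z (Set.univ.pi A) ∂σ = ν (Set.univ.pi (Sum.elim A C)) := by
    intro A C hA hC
    rw [hKν _ (.univ_pi hA) _ (.univ_pi hC)]
    congr 1
    ext x
    simp [Set.mem_pi]
  have hKint : ∀ A : ι → Set X, (∀ i, MeasurableSet (A i)) →
      ∫⁻ z, K z (Set.univ.pi A) ∂σ = ∏ i, μ (A i) := by
    intro A hA
    have h1 := hKr A (fun _ => Set.univ) hA fun _ => .univ
    rw [Set.pi_univ, setLIntegral_univ] at h1
    rw [h1, hind]
    · simp
    · rintro (i | k)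
      exacts [hA i, .univ]
    · exact ⟨.inr (Classical.arbitrary κ), rfl⟩
  have hKconst : ∀ A : ι → Set X, (∀ i, MeasurableSet (A i)) → (∃ i, A i = Set.univ) →
      (fun z => K z (Set.univ.pi A)) =ᵐ[σ] fun _ => ∏ i, μ (A i) := by
    rintro A hA ⟨i, hi⟩
    -- With an `ι`-side free, `ν` of the rectangle over `A` and any `C` factors, so both functions
    -- are densities of the same measure.
    refine (withDensity_eq_iff_of_sigmaFinite (hKm (.univ_pi hA)).aemeasurable
      aemeasurable_const).1 ?_
    have : IsFiniteMeasure (σ.withDensity fun z => K z (Set.univ.pi A)) :=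
      isFiniteMeasure_withDensity (by
        rw [hKint A hA]
        exact ENNReal.prod_ne_top fun i _ => measure_ne_top _ _)
    refine measure_ext_of_rectangles fun C hC => ?_
    rw [withDensity_apply _ (.univ_pi hC), withDensity_apply _ (.univ_pi hC), hKr A C hA hC,
      setLIntegral_const, hσ, Measure.pi_pi, hind]
    · simp
    · rintro (i | k)
      exacts [hA i, hC k]
    · exact ⟨.inl i, hi⟩
  -- Equivariance of the conditional law, from invariance of `ν` and uniqueness of densities.
  have hKequiv : ∀ g, ∀ A : ι → Set X, (∀ i, MeasurableSet (A i)) →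
      (fun z => K z (Set.univ.pi fun i => T.toFun g ⁻¹' A i)) =ᵐ[σ]
        fun z => K (fun k => T.toFun g (z k)) (Set.univ.pi A) := by
    intro g A hA
    have hS := T.measurePreserving_diagonal g κ
    have hpre : MeasurableSet (Set.univ.pi fun i => T.toFun g ⁻¹' A i) :=
      .univ_pi fun i => T.measurable g (hA i)
    refine ae_eq_of_forall_setLIntegral_eq_of_sigmaFinite (hKm hpre)
      ((hKm (.univ_pi hA)).comp hS.measurable) fun C hC _ => ?_
    -- Since `T` is invertible only modulo null sets, `C` is replaced by a preimage under the action
    -- that agrees with it almost everywhere.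
    let D : Set (κ → X) := (fun z k => T.toFun g⁻¹ (z k)) ⁻¹' C
    have hD : MeasurableSet D := T.measurable_diagonal g⁻¹ κ hC
    have hDC : ((fun (z : κ → X) k => T.toFun g (z k)) ⁻¹' D : Set (κ → X)) =ᵐ[σ] C := by
      have h1 : (fun (z : κ → X) k => T.toFun g⁻¹ (T.toFun g (z k))) =ᵐ[σ] fun z k => z k :=
        Measure.ae_eq_pi fun _ => T.inv_comp g
      filter_upwards [h1] with z hz
      change ((fun k => T.toFun g⁻¹ (T.toFun g (z k))) ∈ C) = (z ∈ C)
      rw [hz]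
    rw [← setLIntegral_congr hDC, ← setLIntegral_congr hDC, hKν _ hpre _ (hS.measurable hD),
      hS.setLIntegral_comp_preimage hD (hKm (.univ_pi hA)), hKν _ (.univ_pi hA) _ hD]
    have hE : MeasurableSet {x : ι ⊕ κ → X |
        (fun i => x (.inl i)) ∈ Set.univ.pi A ∧ (fun k => x (.inr k)) ∈ D} :=
      ((measurable_reindex Sum.inl) (.univ_pi hA)).inter ((measurable_reindex Sum.inr) hD)
    conv_rhs => rw [← hinv g, Measure.map_apply (T.measurable_diagonal g _) hE]
    rfl
  let ν' : Measure (ι ⊕ ι → X) :=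
    (σ.bind (K.prod K)).map fun p : (ι → X) × (ι → X) => Sum.elim p.1 p.2
  have : IsProbabilityMeasure ν' := Measure.isProbabilityMeasure_map measurable_sumElim.aemeasurable
  have hν' : ∀ A : ι ⊕ ι → Set X, (∀ i, MeasurableSet (A i)) →
      ν' (Set.univ.pi A) = ∫⁻ z, K z (Set.univ.pi fun i => A (.inl i)) *
        K z (Set.univ.pi fun i => A (.inr i)) ∂σ := by
    intro A hA
    have hm : MeasurableSet (Set.univ.pi (fun i => A (.inl i)) ×ˢ
        Set.univ.pi (fun i => A (.inr i))) :=
      (MeasurableSet.univ_pi fun i => hA _).prod (.univ_pi fun i => hA _)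
    rw [Measure.map_apply measurable_sumElim (.univ_pi hA), preimage_sumElim_rectangle,
      Measure.bind_apply hm (Kernel.aemeasurable _)]
    simp only [Kernel.prod_apply, Measure.prod_prod]
  refine ⟨ν', diagonalInvariant_of_rectangles fun g A hA => ?_, fun A hA hA' => ?_, fun heq => ?_⟩
  · rw [hν' _ fun i => T.measurable g (hA i), hν' A hA]
    have hS := T.measurePreserving_diagonal g κ
    have hm : Measurable fun z => K z (Set.univ.pi fun i => A (.inl i)) *
        K z (Set.univ.pi fun i => A (.inr i)) :=
      (hKm (.univ_pi fun i => hA _)).mul (hKm (.univ_pi fun i => hA _))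
    refine Eq.trans ?_ (hS.lintegral_comp hm)
    refine lintegral_congr_ae ?_
    filter_upwards [hKequiv g (fun i => A (.inl i)) fun i => hA _,
      hKequiv g (fun i => A (.inr i)) fun i => hA _] with z h1 h2
    exact congrArg₂ _ h1 h2
  · rw [hν' A hA, Fintype.prod_sum_type]
    obtain ⟨i | i, hi⟩ := hA'
    · refine (lintegral_congr_ae ((hKconst (fun i => A (.inl i)) (fun i => hA _) ⟨i, hi⟩).mul
        (ae_eq_refl _))).trans ?_
      rw [← hKint (fun i => A (.inr i)) fun i => hA _]
      exact lintegral_const_mul _ (hKm (.univ_pi fun i => hA _))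
    · refine (lintegral_congr_ae ((ae_eq_refl _).mul
        (hKconst (fun i => A (.inr i)) (fun i => hA _) ⟨i, hi⟩))).trans ?_
      rw [← hKint (fun i => A (.inl i)) fun i => hA _]
      exact lintegral_mul_const _ (hKm (.univ_pi fun i => hA _))
  · refine hne (Measure.pi_eq fun A hA => ?_).symm
    -- The same sides are used in both copies, so that the integrand becomes a square.
    have h1 := hν' (Sum.elim (fun i => A (.inl i)) fun i => A (.inl i)) (by
      rintro (i | i) <;> exact hA _)
    rw [heq, Measure.pi_pi, Fintype.prod_sum_type] at h1
    have h2 := ae_eq_const_of_lintegral_mul_self (hKm (.univ_pi fun i => hA (.inl i)))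
      (fun z => prob_le_one) (hKint (fun i => A (.inl i)) fun i => hA _) h1.symm
    have h3 := hKr (fun i => A (.inl i)) (fun k => A (.inr k)) (fun i => hA _) fun k => hA _
    rw [lintegral_congr_ae (ae_restrict_of_ae h2), setLIntegral_const, hσ, Measure.pi_pi] at h3
    rw [Fintype.prod_sum_type, h3]
    congr 2
    ext1 i
    cases i <;> rfl

theorem HasProperJoining.square_fin {T : MPAction G μ} {m a : ℕ} (ha : 0 < a) (ham : a < m)
    (h : HasProperJoining T (Fin m)) : HasProperJoining T (Fin (2 * a)) := by
  obtain ⟨c, rfl⟩ := Nat.exists_eq_add_of_le ham.le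
  have : Nonempty (Fin a) := ⟨⟨0, ha⟩⟩
  have : Nonempty (Fin c) := ⟨⟨0, by omega⟩⟩
  exact (h.reindex finSumFinEquiv).square.reindex
    ((finCongr (two_mul a)).trans finSumFinEquiv.symm)

theorem HasProperJoining.two_mul {T : MPAction G μ} {m : ℕ} (hm : 2 < m)
    (h : HasProperJoining T (Fin m)) {p : ℕ} (hp : 0 < p) : HasProperJoining T (Fin (2 * p)) := by
  have hlarge : ∀ N : ℕ, ∃ m', N + 2 < m' ∧ HasProperJoining T (Fin m') := by
    intro N
    induction N with
    | zero => exact ⟨m, hm, h⟩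
    | succ N ih =>
      obtain ⟨m', hm', h'⟩ := ih
      -- Conditioning on a single coordinate strictly raises the order once `m' > 2`.
      exact ⟨2 * (m' - 1), by omega, h'.square_fin (by omega) (by omega)⟩
  obtain ⟨m', hm', h'⟩ := hlarge p
  exact h'.square_fin hp (by omega)

/-- A nontrivial pairwise independent self-joining of order greater than two yields nontrivial
self-joinings of the classes `M (2 * p - 1, 2 * p)`. -/
theorem exists_isClassM_of_isPairwiseIndependent {T : MPAction G μ} {n : ℕ} (hn : 2 < n)
    {ν : Measure (Fin n → X)} (hν : IsPairwiseIndependent T n ν) (hne : IsNontrivial μ n ν)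
    {p : ℕ} (hp : 1 < p) :
    ∃ ν : Measure (Fin (2 * p) → X),
      IsClassM T (2 * p - 1) (2 * p) ν ∧ IsNontrivial μ (2 * p) ν := by
  obtain ⟨m, hm, h⟩ := exists_hasProperJoining hn hν hne
  exact (h.two_mul hm (by omega)).exists_isClassM (by omega)

end

/-! ### Compactness of couplings with fixed marginals. -/

section

/-- Enlarging the sides of a rectangle changes its measure by at most the measures of the
differences of the sides, computed in the marginals. -/
theorem measure_rectangle_le_add {ι X : Type*} [Fintype ι] [MeasurableSpace X]
    {μ : Measure X} {ν : Measure (ι → X)} (hν : ∀ i, ν.map (fun x => x i) = μ)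
    {A B : ι → Set X} (hA : ∀ i, MeasurableSet (A i)) (hB : ∀ i, MeasurableSet (B i)) :
    ν (Set.univ.pi B) ≤ ν (Set.univ.pi A) + ∑ i, μ (B i \ A i) := by
  have hsub : Set.univ.pi B ⊆ Set.univ.pi A ∪ ⋃ i, (fun x : ι → X => x i) ⁻¹' (B i \ A i) := by
    intro x hx
    by_cases h : ∀ i, x i ∈ A i
    · exact Or.inl fun i _ => h i
    · push Not at h
      obtain ⟨i, hi⟩ := h
      exact Or.inr (Set.mem_iUnion.2 ⟨i, hx i trivial, hi⟩)
  refine (measure_mono hsub).trans ((measure_union_le _ _).trans ?_)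
  gcongr
  refine (measure_iUnion_fintype_le _ _).trans (Finset.sum_le_sum fun i _ => ?_)
  conv_rhs => rw [← hν i, Measure.map_apply (measurable_pi_apply i) ((hB i).diff (hA i))]

/-- Couplings with fixed marginals on a standard Borel space are compact for the convergence on
measurable rectangles. -/
theorem exists_tendsto_rectangles {ι X α : Type*} [Fintype ι] [MeasurableSpace X]
    [StandardBorelSpace X] {μ : Measure X} [IsProbabilityMeasure μ] (U : Ultrafilter α)
    (ν : α → Measure (ι → X)) [∀ a, IsProbabilityMeasure (ν a)]
    (hν : ∀ a i, (ν a).map (fun x => x i) = μ) :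
    ∃ ν₀ : Measure (ι → X), IsProbabilityMeasure ν₀ ∧ ∀ A : ι → Set X,
      (∀ i, MeasurableSet (A i)) →
        Tendsto (fun a => ν a (Set.univ.pi A)) U (𝓝 (ν₀ (Set.univ.pi A))) := by
  let := upgradeStandardBorel X
  let N : α → ProbabilityMeasure (ι → X) := fun a => ⟨ν a, inferInstance⟩
  -- The mass outside a cube `K ^ ι` is at most the sum of the marginal masses outside `K`,
  -- uniformly in `a`.
  have htight : IsTightMeasureSet {((ρ : ProbabilityMeasure (ι → X)) : Measure (ι → X)) |
      ρ ∈ Set.range N} := by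
    rw [isTightMeasureSet_iff_exists_isCompact_measure_compl_le]
    intro ε hε
    have hμ : IsTightMeasureSet ({μ} : Set (Measure X)) := isTightMeasureSet_singleton
    rw [isTightMeasureSet_iff_exists_isCompact_measure_compl_le] at hμ
    obtain ⟨K, hK, hKε⟩ := hμ (ε / (Fintype.card ι + 1 : ENNReal))
      (ENNReal.div_pos hε.ne' (by finiteness))
    refine ⟨Set.univ.pi fun _ => K, isCompact_univ_pi fun _ => hK, ?_⟩
    rintro _ ⟨_, ⟨a, rfl⟩, rfl⟩
    have hle := measure_rectangle_le_add (hν a) (A := fun _ => K) (B := fun _ => Set.univ)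
      (fun _ => hK.measurableSet) (fun _ => .univ)
    have hm : MeasurableSet (Set.univ.pi fun _ : ι => K) := .univ_pi fun _ => hK.measurableSet
    change ν a _ ≤ ε
    rw [prob_compl_eq_one_sub hm]
    rw [Set.pi_univ, measure_univ] at hle
    refine tsub_le_iff_left.2 (hle.trans ?_)
    gcongr
    calc ∑ _i : ι, μ (Set.univ \ K) ≤ ∑ _i : ι, ε / (Fintype.card ι + 1 : ENNReal) := by
          gcongr
          rw [← Set.compl_eq_univ_sdiff]
          exact hKε μ rfl
      _ = Fintype.card ι * (ε / (Fintype.card ι + 1 : ENNReal)) := by simp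
      _ ≤ (Fintype.card ι + 1) * (ε / (Fintype.card ι + 1 : ENNReal)) := by
          gcongr; exact le_self_add
      _ ≤ ε := ENNReal.mul_div_le
  obtain ⟨N₀, -, hlim⟩ := (isCompact_closure_of_isTightMeasureSet htight).ultrafilter_le_nhds
    (U.map N) (le_principal_iff.2 (mem_map.2 (univ_mem' fun a => subset_closure ⟨a, rfl⟩)))
  replace hlim : Tendsto N U (𝓝 N₀) := hlim
  obtain ⟨ν₀, hν₀⟩ : ∃ ν₀ : Measure (ι → X), (N₀ : Measure (ι → X)) = ν₀ := ⟨_, rfl⟩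
  have : IsProbabilityMeasure ν₀ := hν₀ ▸ inferInstance
  refine ⟨ν₀, inferInstance, fun A hA => ?_⟩
  -- Weak convergence controls closed and open rectangles. Approximating each side from inside and
  -- outside costs at most `ε` per coordinate, uniformly in `a` because the marginals are fixed. The
  -- extra `ε` comes from the portmanteau bounds.
  have key : ∀ ε : ENNReal, ε ≠ 0 → ∀ᶠ a in U,
      ν a (Set.univ.pi A) ≤ ν₀ (Set.univ.pi A) + (ε + Fintype.card ι * ε) ∧
      ν₀ (Set.univ.pi A) ≤ ν a (Set.univ.pi A) + (ε + Fintype.card ι * ε) := by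
    intro ε hε
    have hF : ∀ i, ∃ F ⊆ A i, IsClosed F ∧ μ (A i \ F) < ε := fun i =>
      (hA i).exists_isClosed_sdiff_lt (measure_ne_top _ _) hε
    have hO : ∀ i, ∃ O ⊇ A i, IsOpen O ∧ μ O < ⊤ ∧ μ (O \ A i) < ε := fun i =>
      (hA i).exists_isOpen_sdiff_lt (measure_ne_top _ _) hε
    choose F hFA hFc hFε using hF
    choose O hAO hOo _ hOε using hO
    have h1 := ProbabilityMeasure.limsup_measure_closed_le_of_tendsto hlim
      (isClosed_set_pi fun i _ => hFc i : IsClosed (Set.univ.pi F))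
    have h2 := ProbabilityMeasure.le_liminf_measure_open_of_tendsto hlim
      (isOpen_set_pi Set.finite_univ fun i _ => hOo i : IsOpen (Set.univ.pi O))
    rw [hν₀] at h1 h2
    have h1' : ∀ᶠ a in U, ν a (Set.univ.pi F) < ν₀ (Set.univ.pi F) + ε :=
      eventually_lt_of_limsup_lt (h1.trans_lt (ENNReal.lt_add_right (measure_ne_top _ _) hε))
    have h2' : ∀ᶠ a in U, ν₀ (Set.univ.pi O) ≤ ν a (Set.univ.pi O) + ε := by
      -- Subtracting `ε` is strictly decreasing only from a nonzero value.
      by_cases h0 : ν₀ (Set.univ.pi O) = 0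
      · simp [h0]
      · have := eventually_lt_of_lt_liminf
          ((ENNReal.sub_lt_self (measure_ne_top _ _) h0 hε).trans_le h2)
        filter_upwards [this] with a ha
        exact tsub_le_iff_right.1 ha.le
    have hsum : ∀ D : ι → Set X, (∀ i, μ (D i) < ε) → ∑ i, μ (D i) ≤ Fintype.card ι * ε :=
      fun D hD => (Finset.sum_le_sum fun i _ => (hD i).le).trans (by simp)
    filter_upwards [h1', h2'] with a ha1 ha2
    constructor
    · calc ν a (Set.univ.pi A) ≤ ν a (Set.univ.pi F) + ∑ i, μ (A i \ F i) :=
            measure_rectangle_le_add (hν a) (fun i => (hFc i).measurableSet) hA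
        _ ≤ (ν₀ (Set.univ.pi F) + ε) + Fintype.card ι * ε :=
            add_le_add ha1.le (hsum _ hFε)
        _ ≤ (ν₀ (Set.univ.pi A) + ε) + Fintype.card ι * ε := by
            gcongr; exact hFA _
        _ = _ := add_assoc _ _ _
    · calc ν₀ (Set.univ.pi A) ≤ ν₀ (Set.univ.pi O) :=
            measure_mono (Set.pi_mono fun i _ => hAO i)
        _ ≤ ν a (Set.univ.pi O) + ε := ha2
        _ ≤ (ν a (Set.univ.pi A) + ∑ i, μ (O i \ A i)) + ε := by
            gcongr
            exact measure_rectangle_le_add (hν a) hA fun i => (hOo i).measurableSet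
        _ ≤ (ν a (Set.univ.pi A) + Fintype.card ι * ε) + ε := by
            gcongr; exact hsum _ hOε
        _ = _ := by ring
  refine (ENNReal.tendsto_nhds (measure_ne_top _ _)).2 fun ε hε => ?_
  have hpos : ε / (1 + Fintype.card ι : ENNReal) ≠ 0 := (ENNReal.div_pos hε.ne' (by finiteness)).ne'
  filter_upwards [key _ hpos] with a ha
  have hle : ε / (1 + Fintype.card ι : ENNReal) +
      Fintype.card ι * (ε / (1 + Fintype.card ι : ENNReal)) ≤ ε := by
    rw [← one_add_mul]
    exact ENNReal.mul_div_le
  exact ⟨tsub_le_iff_right.2 (ha.2.trans (by gcongr)), ha.1.trans (by gcongr)⟩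

end

/-! ### Graph joinings and the failure of multiple mixing. -/

section
variable {G X : Type*} [Group G] [MeasurableSpace X] {μ : Measure X}

/-- The joining carried by the graph of the maps `T_g⁻¹`, `g` in a finite family. -/
noncomputable def graphJoining {ι : Type*} (T : MPAction G μ) (γ : ι → G) : Measure (ι → X) :=
  μ.map fun x i => T.toFun (γ i)⁻¹ x

theorem measurable_graph {ι : Type*} (T : MPAction G μ) (γ : ι → G) :
    Measurable fun (x : X) (i : ι) => T.toFun (γ i)⁻¹ x :=
  measurable_pi_lambda _ fun _ => T.measurable _

instance {ι : Type*} [IsProbabilityMeasure μ] (T : MPAction G μ) (γ : ι → G) :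
    IsProbabilityMeasure (graphJoining T γ) :=
  Measure.isProbabilityMeasure_map (measurable_graph T γ).aemeasurable

theorem graphJoining_rectangle {ι : Type*} [Fintype ι] (T : MPAction G μ) (γ : ι → G)
    {A : ι → Set X} (hA : ∀ i, MeasurableSet (A i)) :
    graphJoining T γ (Set.univ.pi A) = μ (⋂ i, T.toFun (γ i)⁻¹ ⁻¹' A i) := by
  rw [graphJoining, Measure.map_apply (measurable_graph T γ) (.univ_pi hA)]
  congr 1
  ext x
  simp [Set.mem_pi]

theorem graphJoining_marginal {ι : Type*} (T : MPAction G μ) (γ : ι → G) (i : ι) :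
    (graphJoining T γ).map (fun x => x i) = μ := by
  rw [graphJoining, Measure.map_map (measurable_pi_apply i) (measurable_graph T γ)]
  exact (T.measurePreserving _).map_eq

/-- Two-dimensional faces of a graph joining. -/
theorem graphJoining_pair {ι : Type*} [Fintype ι] (T : MPAction G μ) (γ : ι → G)
    {A : ι → Set X} (hA : ∀ i, MeasurableSet (A i)) {i j : ι}
    (h : ∀ k, k ≠ i → k ≠ j → A k = Set.univ) :
    graphJoining T γ (Set.univ.pi A) = μ (A i ∩ T.toFun ((γ i)⁻¹ * γ j)⁻¹ ⁻¹' A j) := by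
  have hm : MeasurableSet (A i ∩ T.toFun ((γ i)⁻¹ * γ j)⁻¹ ⁻¹' A j) :=
    (hA i).inter (T.measurable _ (hA j))
  -- Pulling the pair back by `T_{γ i}⁻¹` turns the quotient `(γ i)⁻¹ * γ j` into `γ j`.
  rw [graphJoining_rectangle T γ hA, ← (T.measurePreserving (γ i)⁻¹).measure_preimage
    hm.nullMeasurableSet]
  refine measure_congr ?_
  have hmul := T.map_mul ((γ i)⁻¹ * γ j)⁻¹ (γ i)⁻¹
  rw [show ((γ i)⁻¹ * γ j)⁻¹ * (γ i)⁻¹ = (γ j)⁻¹ by group] at hmul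
  filter_upwards [hmul] with x hx
  change (x ∈ ⋂ i, T.toFun (γ i)⁻¹ ⁻¹' A i) = (T.toFun (γ i)⁻¹ x ∈ A i ∧
    (T.toFun ((γ i)⁻¹ * γ j)⁻¹ ∘ T.toFun (γ i)⁻¹) x ∈ A j)
  rw [← hx, Set.mem_iInter, eq_iff_iff]
  refine ⟨fun hk => ⟨hk i, hk j⟩, fun hk k => ?_⟩
  by_cases hki : k = i
  · exact hki ▸ hk.1
  by_cases hkj : k = j
  · exact hkj ▸ hk.2
  rw [h k hki hkj]; trivial

/-- Applying `T_g` diagonally amounts, by commutativity, to moving the base point by `T_g`, which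
preserves `μ`. -/
theorem graphJoining_invariant {G : Type*} [CommGroup G] {ι : Type*} [Finite ι]
    (T : MPAction G μ) (γ : ι → G) : DiagonalInvariant T (graphJoining T γ) := by
  intro g
  rw [graphJoining, Measure.map_map (T.measurable_diagonal g ι) (measurable_graph T γ)]
  have hg : (μ.map (T.toFun g)).map (fun x i => T.toFun (γ i)⁻¹ x) =
      μ.map fun x i => T.toFun (γ i)⁻¹ x := by rw [(T.measurePreserving g).map_eq]
  rw [← hg, Measure.map_map (measurable_graph T γ) (T.measurable g)]
  refine Measure.map_congr ?_
  have h : ∀ᵐ x ∂μ, ∀ i, T.toFun g (T.toFun (γ i)⁻¹ x) = T.toFun (γ i)⁻¹ (T.toFun g x) := by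
    refine ae_all_iff.2 fun i => ?_
    have h1 := T.map_mul g (γ i)⁻¹
    rw [mul_comm] at h1
    exact h1.symm.trans (T.map_mul (γ i)⁻¹ g)
  filter_upwards [h] with x hx
  exact funext hx

theorem IsMixing.tendsto [TopologicalSpace G] [IsTopologicalGroup G] {T : MPAction G μ}
    (h : IsMixing T) {A B : Set X} (hA : MeasurableSet A) (hB : MeasurableSet B) :
    Tendsto (fun g : G => μ (A ∩ T.toFun g⁻¹ ⁻¹' B)) (cocompact G) (𝓝 (μ A * μ B)) := by
  have h1 := h ![A, B] (by simp [Fin.forall_fin_two, hA, hB])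
  -- The two conditions are `g → ∞` and `g⁻¹ → ∞`, equivalent because inversion is a homeomorphism.
  have h2 : Tendsto (fun (g : G) (_ : Fin 1) => g) (cocompact G) (tendToInfinityApart G 1) := by
    simp only [tendToInfinityApart, tendsto_iInf, tendsto_comap_iff]
    have hinv := (Homeomorph.inv G).isClosedEmbedding.tendsto_cocompact
    intro i j hij
    fin_cases i <;> fin_cases j
    · exact absurd rfl hij
    · simpa [Function.comp_def] using! tendsto_id
    · simpa [Function.comp_def] using hinv
    · exact absurd rfl hij
  have h3 := h1.comp h2
  rw [show ∏ i : Fin (1 + 1), μ (![A, B] i) = μ A * μ B from Fin.prod_univ_two _] at h3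
  refine h3.congr fun g => measure_congr ?_
  filter_upwards [T.map_one] with x hx
  change (x ∈ ⋂ i, _) = (x ∈ A ∩ _)
  rw [Set.mem_iInter, eq_iff_iff]
  refine (Fin.forall_fin_two (p := fun i : Fin 2 => x ∈ T.toFun
    ((Fin.cons 1 fun _ => g : Fin 2 → G) i)⁻¹ ⁻¹' (![A, B] i))).trans ?_
  simp [hx]

theorem tendsto_tendToInfinityApart (G : Type*) [Group G] [TopologicalSpace G] (k : ℕ)
    {i j : Fin (k + 1)} (hij : i ≠ j) :
    Tendsto (fun g : Fin k → G =>
      ((Fin.cons 1 g : Fin (k + 1) → G) i)⁻¹ * (Fin.cons 1 g : Fin (k + 1) → G) j)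
      (tendToInfinityApart G k) (cocompact G) :=
  tendsto_iff_comap.2 ((iInf_le _ i).trans ((iInf_le _ j).trans (iInf_le _ hij)))

/-- A mixing action of a commutative group which is not mixing of multiplicity `k` has a nontrivial
pairwise independent self-joining of order `k + 1`. -/
theorem exists_isPairwiseIndependent_of_not_isMixingOfMultiplicity {G : Type*} [CommGroup G]
    [TopologicalSpace G] [IsTopologicalGroup G] [StandardBorelSpace X] [IsProbabilityMeasure μ]
    {T : MPAction G μ} (hT : IsMixing T) {k : ℕ} (hk : ¬ IsMixingOfMultiplicity T k) :
    ∃ ν : Measure (Fin (k + 1) → X),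
      IsPairwiseIndependent T (k + 1) ν ∧ IsNontrivial μ (k + 1) ν := by
  simp only [IsMixingOfMultiplicity, not_forall] at hk
  obtain ⟨A, hA, hlim⟩ := hk
  -- An ultrafilter both witnesses the failure of convergence and supplies the limit joining, with
  -- no countability assumption on `G`.
  rw [tendsto_iff_ultrafilter] at hlim
  push Not at hlim
  obtain ⟨U, hU, hUA⟩ := hlim
  obtain ⟨ν, hν, hνU⟩ := exists_tendsto_rectangles U
    (fun g : Fin k → G => graphJoining T (Fin.cons 1 g : Fin (k + 1) → G))
    fun g i => graphJoining_marginal T _ i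
  refine ⟨ν, ⟨⟨fun i => ?_, ?_⟩, fun s hs => ?_⟩, fun h => hUA ?_⟩
  · refine Measure.ext fun B hB => ?_
    have hB' : ∀ j, MeasurableSet (Function.update (fun _ : Fin (k + 1) => Set.univ) i B j) := by
      intro j
      by_cases hj : j = i
      · subst hj; simpa using hB
      · simp [hj]
    have h1 := hνU _ hB'
    have h2 : ∀ g : Fin k → G, graphJoining T (Fin.cons 1 g : Fin (k + 1) → G)
        (Set.univ.pi (Function.update (fun _ => Set.univ) i B)) = μ B := fun g => by
      conv_rhs => rw [← graphJoining_marginal T (Fin.cons 1 g : Fin (k + 1) → G) i,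
        Measure.map_apply (measurable_pi_apply i) hB]
      rw [Set.univ_pi_update_univ]
    simp only [h2] at h1
    rw [Measure.map_apply (measurable_pi_apply i) hB, tendsto_nhds_unique tendsto_const_nhds h1,
      Set.univ_pi_update_univ]
  · refine diagonalInvariant_of_rectangles fun g B hB => ?_
    refine tendsto_nhds_unique (hνU _ fun i => T.measurable g (hB i)) ?_
    simp only [(graphJoining_invariant T _).rectangle g hB]
    exact hνU B hB
  · refine (Measure.pi_eq fun B hB => ?_).symm
    obtain ⟨i, j, hij, rfl⟩ := Finset.card_eq_two.1 hs
    have hinj := Subtype.val_injective (p := fun l => l ∈ ({i, j} : Finset (Fin (k + 1))))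
    refine (map_reindex_rectangle Subtype.val hinj ν hB).trans ?_
    rw [← prod_extend (μ := μ) hinj]
    set C := Function.extend Subtype.val B fun _ => Set.univ
    have hC : ∀ i, MeasurableSet (C i) := measurableSet_extend hinj hB
    have hCu : ∀ l, l ≠ i → l ≠ j → C l = Set.univ := fun l hi hj =>
      Function.extend_apply' _ _ _ (by simp [hi, hj])
    rw [← Finset.prod_subset (Finset.subset_univ {i, j}), Finset.prod_pair hij]
    · refine tendsto_nhds_unique (hνU C hC) ?_
      simp only [graphJoining_pair T _ hC hCu]
      exact (hT.tendsto (hC i) (hC j)).comp ((tendsto_tendToInfinityApart G k hij).mono_left hU)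
    · intro l _ hl
      simp only [Finset.mem_insert, Finset.mem_singleton, not_or] at hl
      rw [hCu l hl.1 hl.2, measure_univ]
  -- A product limit would give the mixing limit along `U` for the very sets `A` on which it fails.
  · have h1 := hνU A hA
    simpa only [h, Measure.pi_pi, graphJoining_rectangle T _ hA] using h1

end

end Joinings

theorem mainTheorem3 {X : Type*} [MeasurableSpace X] [StandardBorelSpace X]
    (μ : Measure X) [IsProbabilityMeasure μ] :
    (∀ (G : Type*) [Group G] (T : Joinings.MPAction G μ),
      (∃ n : ℕ, 2 < n ∧ ∃ ν : Measure (Fin n → X),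
        Joinings.IsPairwiseIndependent T n ν ∧ Joinings.IsNontrivial μ n ν) →
      ∀ p : ℕ, 1 < p → ∃ ν : Measure (Fin (2 * p) → X),
        Joinings.IsClassM T (2 * p - 1) (2 * p) ν ∧ Joinings.IsNontrivial μ (2 * p) ν) ∧
    (∀ (G : Type*) [CommGroup G] [TopologicalSpace G] [IsTopologicalGroup G]
      (T : Joinings.MPAction G μ),
      Joinings.IsMixing T →
      (∃ k : ℕ, 1 < k ∧ ¬ Joinings.IsMixingOfMultiplicity T k) →
      ∀ p : ℕ, 1 < p → ∃ ν : Measure (Fin (2 * p) → X),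
        Joinings.IsClassM T (2 * p - 1) (2 * p) ν ∧ Joinings.IsNontrivial μ (2 * p) ν) := by
  refine ⟨fun G _ T ⟨n, hn, ν, hν, hne⟩ p hp =>
    Joinings.exists_isClassM_of_isPairwiseIndependent hn hν hne hp,
    fun G _ _ _ T hT ⟨k, hk, hmix⟩ p hp => ?_⟩
  obtain ⟨ν, hν, hne⟩ :=
    Joinings.exists_isPairwiseIndependent_of_not_isMixingOfMultiplicity hT hmix
  exact Joinings.exists_isClassM_of_isPairwiseIndependent (by omega) hν hne hp
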